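/- Throughout, $[n]=\{1,\dots,n\}$; a tournament on $[n]$ is a digraph without loops in which any two distinct vertices are joined by exactly one arc; and for a random variable $X$ taking finitely many values, $H(X)=-\sum_x \Pr(X=x)\log_2\Pr(X=x)$ (with $0\log_2 0=0$). **Theorem (Leighton–Moitra conjecture).** For every $\varepsilon>0$ there is $\vartheta=\vartheta_\varepsilon>0$, depending only on $\varepsilon$, such that the following holds. Let $n$ be a natural number, let $T$ be any tournament on $[n]$, and let $\sigma$ be a random (not necessarily uniform) permutation of $[n]$ such that $$\Pr(\sigma(u)<\sigma(v))>\tfrac12+\varepsilon\quad\text{for every arc } uv \text{ of } T.$$ Then $$H(\sigma)\le(1-\vartheta)\log_2 n!.$$ Moreover, one can take $\vartheta_\varepsilon=\exp[-\varepsilon^{-O(1)}]$; that is, there is an absolute constant $C>0$ such that the above holds with $\vartheta_\varepsilon=\exp(-\varepsilon^{-C})$ for all $0<\varepsilon<1/2$. (For $\varepsilon\ge 1/2$ and $n\ge2$ the hypothesis cannot hold.) -/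

import Mathlib

open MeasureTheory

/-- A tournament: a digraph without loops in which every two distinct vertices are joined by
exactly one arc. -/
def IsTournament {V : Type*} (T : Digraph V) : Prop :=
  (∀ v, ¬ T.Adj v v) ∧ ∀ u v, u ≠ v → Xor (T.Adj u v) (T.Adj v u)

/-- The binary (base 2 Shannon) entropy of a random variable `X` with values in a finite set,
`H(X) = - ∑ₓ P(X = x) log₂ P(X = x)`, with the convention `0 log₂ 0 = 0`. -/
noncomputable def entropyTwo {Ω S : Type*} [MeasurableSpace Ω] [Fintype S]
    (P : Measure Ω) (X : Ω → S) : ℝ :=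
  - ∑ x : S, P.real (X ⁻¹' {x}) * Real.logb 2 (P.real (X ⁻¹' {x}))

/-!
Entropy is replaced by relative entropy with respect to the uniform ordering. By Gibbs' inequality
(`entropy_le_sub_of_expect_exp_le_one`) the entropy of `σ` falls short of `log n!` by at least
`E Φ(σ)`, for every potential `Φ` whose exponential moment under the uniform ordering is at
most `1`. The proof constructs such a `Φ` with `E Φ(σ)` of order `n log n`.

Encode the tournament by signs `s u v = ±1` and an ordering by `ordSign σ u v = ±1`. The hypothesis
says that `E [s u v * ordSign σ u v] ≥ 2 ε` for all pairs. Let `A`, `B` be disjoint sets of the same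
size `a` for which no pair of subsets of relative size `1 / N`, where `N` is about `16 / ε`, is
noticeably denser than `A`, `B`. Such pairs exist in every large `W`, with `a` a constant proportion
of `|W|`, by density increment (`exists_upper_regular_pair`). For an ordering, the sum of
`s u v * ordSign σ u v` over `A × B` then exceeds `c * U`, with `c` the mean of `s` and `U` the sum
of `ordSign σ u v` (the Mann-Whitney statistic), by at most `ε a²`, because the
ordering cuts `A` and `B` into blocks of which few pairs are interlaced (`sum_mul_ordSign_le`).
Hence `E [c * U] ≥ ε a²`, whereas for the uniform ordering `U / a` is sub-Gaussian with variance
proxy `a` (`expect_exp_sum_ordSign_le`, by decomposing `A × B` into perfect matchings). So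
`ε c U / a - ε² a / 2` has exponential moment at most `1` and expectation at least `ε² a / 2`.

Under the uniform ordering `U` is independent of the relative orders inside `A`, inside `B` and
inside the rest `R` of `W`, and these are independent of each other
(`expect_mul_of_local_of_invariant`). Potentials for `A`, `B` and `R` can therefore be added to this
one, and the recursion (`exists_potential`) yields `E Φ ≥ θ n log (n / K)` with `K = 2 N ^ N` and
`θ` at least polynomial in `ε`. This suffices for `n ≥ K²`. For smaller `n`, the order of a single pair
accounts for a deficit of `2 ε²`, which exceeds `ϑ log n!` when `ϑ = exp (-ε ^ (-20))`
(`entropy_le_of_sign_correlation`).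
-/

open scoped BigOperators

/-! ### Relative orders of disjoint sets in a uniformly random ordering -/

/-- The sign of the pair `(u, v)` in the ordering `σ`: `1` if `u` comes before `v`, else `-1`. -/
def ordSign {n : ℕ} (σ : Equiv.Perm (Fin n)) (u v : Fin n) : ℝ := if σ u < σ v then 1 else -1

/-- `f σ` depends only on the relative order of the elements of `W` in the ordering `σ`. -/
def IsOrderLocal {n : ℕ} (W : Finset (Fin n)) (f : Equiv.Perm (Fin n) → ℝ) : Prop :=
  ∀ σ τ : Equiv.Perm (Fin n), (∀ u ∈ W, ∀ v ∈ W, (σ u < σ v ↔ τ u < τ v)) → f σ = f τ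

/-- `h` does not change when the elements of `W` are permuted among themselves. -/
def IsPermInvariant {n : ℕ} (W : Finset (Fin n)) (h : Equiv.Perm (Fin n) → ℝ) : Prop :=
  ∀ g : Equiv.Perm (Fin n), (∀ x, x ∉ W → g x = x) → ∀ σ, h (σ * g) = h σ

lemma apply_mem_of_fixes_compl {n : ℕ} {W : Finset (Fin n)} {g : Equiv.Perm (Fin n)}
    (hg : ∀ x, x ∉ W → g x = x) {x : Fin n} (hx : x ∈ W) : g x ∈ W := by
  by_contra h
  have := g.injective (hg _ h)
  exact h (this.symm ▸ hx)

/-- The elements of `W` can be permuted among themselves so that their order in `σ` becomes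
their order in `τ`. -/
lemma exists_perm_order_eq {n : ℕ} (W : Finset (Fin n)) (σ τ : Equiv.Perm (Fin n)) :
    ∃ g : Equiv.Perm W, ∀ u v : W, (σ (g u) < σ (g v) ↔ τ u < τ v) := by
  have e₁ := (W.map τ.toEmbedding).orderIsoOfFin (Finset.card_map _)
  have e₂ := (W.map σ.toEmbedding).orderIsoOfFin (Finset.card_map _)
  let e := e₁.symm.trans e₂
  let m : ∀ ρ : Equiv.Perm (Fin n), W ≃ W.map ρ.toEmbedding := fun ρ =>
    ρ.subtypeEquiv fun x => by simp
  refine ⟨((m τ).trans e.toEquiv).trans (m σ).symm, fun u v => ?_⟩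
  have key : ∀ y : W.map σ.toEmbedding, σ ((m σ).symm y) = (y : Fin n) := fun y => by
    obtain ⟨z, rfl⟩ := (m σ).surjective y
    rw [Equiv.symm_apply_apply]
    rfl
  simp only [Equiv.trans_apply, key]
  rw [Subtype.coe_lt_coe]
  change e _ < e _ ↔ _
  rw [e.lt_iff_lt, ← Subtype.coe_lt_coe]
  rfl

/-- In a uniformly random ordering, the relative order of the elements of `W` is independent of
every quantity that is symmetric in the elements of `W`. -/
lemma expect_mul_of_local_of_invariant {n : ℕ} {W : Finset (Fin n)}
    {f h : Equiv.Perm (Fin n) → ℝ} (hf : IsOrderLocal W f) (hh : IsPermInvariant W h) :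
    𝔼 σ, f σ * h σ = (𝔼 σ, f σ) * 𝔼 σ, h σ := by
  let ι : Equiv.Perm W →* Equiv.Perm (Fin n) := Equiv.Perm.ofSubtype
  have hι : ∀ g x, x ∉ W → ι g x = x := fun g x hx =>
    Equiv.Perm.ofSubtype_apply_of_not_mem g hx
  have hιW : ∀ g (x : W), ι g x = g x := fun g x => Equiv.Perm.ofSubtype_apply_coe g x
  have hconst : ∀ σ, 𝔼 g, f (σ * ι g) = 𝔼 g, f (1 * ι g) := by
    intro σ
    obtain ⟨g₀, hg₀⟩ := exists_perm_order_eq W σ 1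
    rw [← Fintype.expect_equiv (Equiv.mulLeft g₀) (fun g => f (σ * ι (g₀ * g))) _ (fun g => rfl)]
    refine Finset.expect_congr rfl fun g _ => hf _ _ fun u hu v hv => ?_
    have h1 := hg₀ (g ⟨u, hu⟩) (g ⟨v, hv⟩)
    have e : ∀ x (hx : x ∈ W), ι g x = g ⟨x, hx⟩ := fun x hx => hιW g ⟨x, hx⟩
    simp only [map_mul, Equiv.Perm.mul_apply, e u hu, e v hv, hιW] at h1 ⊢
    exact h1
  have key : ∀ k : Equiv.Perm (Fin n) → ℝ, IsPermInvariant W k →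
      𝔼 σ, f σ * k σ = (𝔼 g, f (1 * ι g)) * 𝔼 σ, k σ := by
    intro k hk
    have h1 : ∀ g : Equiv.Perm W, 𝔼 σ, f σ * k σ = 𝔼 σ, f (σ * ι g) * k σ := fun g => by
      refine (Fintype.expect_equiv (Equiv.mulRight (ι g)) _ _ fun σ => ?_).symm
      simp [hk (ι g) (hι g) σ]
    have h2 : 𝔼 σ, f σ * k σ = 𝔼 g : Equiv.Perm W, 𝔼 σ, f (σ * ι g) * k σ := by
      rw [← Finset.expect_congr rfl (fun g _ => h1 g), Fintype.expect_const]
    rw [h2, Finset.expect_comm, Finset.mul_expect]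
    refine Finset.expect_congr rfl fun σ _ => ?_
    rw [← Finset.expect_mul, hconst]
  have h1 := key (fun _ => 1) (fun _ _ _ => rfl)
  rw [Fintype.expect_const] at h1
  simp only [mul_one] at h1
  rw [key h hh, h1]

lemma IsOrderLocal.mono {n : ℕ} {W W' : Finset (Fin n)} {f : Equiv.Perm (Fin n) → ℝ}
    (hf : IsOrderLocal W f) (h : W ⊆ W') : IsOrderLocal W' f :=
  fun σ τ hs => hf σ τ fun u hu v hv => hs u (h hu) v (h hv)

lemma IsOrderLocal.comp {n : ℕ} {W : Finset (Fin n)} {f : Equiv.Perm (Fin n) → ℝ}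
    (hf : IsOrderLocal W f) (φ : ℝ → ℝ) : IsOrderLocal W (fun σ => φ (f σ)) :=
  fun σ τ hs => congrArg φ (hf σ τ hs)

lemma IsPermInvariant.mul {n : ℕ} {W : Finset (Fin n)} {f h : Equiv.Perm (Fin n) → ℝ}
    (hf : IsPermInvariant W f) (hh : IsPermInvariant W h) :
    IsPermInvariant W (fun σ => f σ * h σ) :=
  fun g hg σ => by simp only [hf g hg σ, hh g hg σ]

lemma IsOrderLocal.isPermInvariant {n : ℕ} {W W' : Finset (Fin n)} {f : Equiv.Perm (Fin n) → ℝ}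
    (hf : IsOrderLocal W f) (h : Disjoint W W') : IsPermInvariant W' f := fun g hg σ =>
  hf _ _ fun u hu v hv => by
    simp [hg u (Finset.disjoint_left.1 h hu), hg v (Finset.disjoint_left.1 h hv)]

/-! ### Exponential moments of the Mann-Whitney statistic -/

lemma ordSign_swap {n : ℕ} (σ : Equiv.Perm (Fin n)) {u v : Fin n} (h : u ≠ v) :
    ordSign σ v u = -ordSign σ u v := by
  have : σ u ≠ σ v := fun h' => h (σ.injective h')
  unfold ordSign
  rcases lt_or_gt_of_ne this with h1 | h1
  · simp [h1, h1.not_gt]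
  · simp [h1, h1.not_gt]

lemma isOrderLocal_ordSign {n : ℕ} (u v : Fin n) :
    IsOrderLocal {u, v} (fun σ => ordSign σ u v) := fun σ τ h => by
  simp only [ordSign, h u (by simp) v (by simp)]

lemma expect_exp_ordSign_le {n : ℕ} {u v : Fin n} (h : u ≠ v) (t : ℝ) :
    𝔼 σ : Equiv.Perm (Fin n), Real.exp (t * ordSign σ u v) ≤ Real.exp (t ^ 2 / 2) := by
  have h1 : 𝔼 σ : Equiv.Perm (Fin n), Real.exp (t * ordSign σ u v) =
      𝔼 σ : Equiv.Perm (Fin n), Real.exp (-(t * ordSign σ u v)) := by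
    refine Fintype.expect_equiv (Equiv.mulRight (Equiv.swap u v)) _ _ fun σ => ?_
    have : ordSign (σ * Equiv.swap u v) u v = ordSign σ v u := by simp [ordSign]
    simp [this, ordSign_swap σ h]
  have h2 : ∀ σ : Equiv.Perm (Fin n), Real.exp (t * ordSign σ u v)
      + Real.exp (-(t * ordSign σ u v)) = 2 * Real.cosh t := fun σ => by
    rw [Real.cosh_eq]
    unfold ordSign
    split_ifs <;> simp <;> ring
  have h3 : 𝔼 σ : Equiv.Perm (Fin n), Real.exp (t * ordSign σ u v)
      + 𝔼 σ : Equiv.Perm (Fin n), Real.exp (-(t * ordSign σ u v)) = 2 * Real.cosh t := by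
    rw [← Finset.expect_add_distrib, Finset.expect_congr rfl (fun σ _ => h2 σ),
      Fintype.expect_const]
  have := Real.cosh_le_exp_half_sq t
  linarith

/-- Along a matching, the signs of a uniformly random ordering are independent, which gives their
sum a sub-Gaussian moment generating function. -/
lemma expect_exp_sum_matching_le {n : ℕ} {ι : Type*} [DecidableEq ι] (a b : ι → Fin n)
    (ha : Function.Injective a) (hb : Function.Injective b) (hab : ∀ i j, a i ≠ b j) (t : ℝ)
    (S : Finset ι) :
    𝔼 σ : Equiv.Perm (Fin n), Real.exp (t * ∑ i ∈ S, ordSign σ (a i) (b i))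
      ≤ Real.exp (t ^ 2 / 2 * S.card) := by
  induction S using Finset.induction_on with
  | empty => simp
  | insert i S hi ih =>
    simp only [Finset.sum_insert hi, mul_add, Real.exp_add]
    rw [expect_mul_of_local_of_invariant (W := {a i, b i})
      (f := fun σ => Real.exp (t * ordSign σ (a i) (b i)))
      ((isOrderLocal_ordSign _ _).comp fun x => Real.exp (t * x))]
    · rw [Finset.card_insert_of_notMem hi]
      push_cast
      rw [mul_add, mul_one, add_comm, Real.exp_add]
      exact mul_le_mul (expect_exp_ordSign_le (hab i i) t) ih
        (Finset.expect_nonneg fun _ _ => (Real.exp_pos _).le) (Real.exp_pos _).le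
    · intro g hg σ
      refine congrArg (fun x => Real.exp (t * x)) ?_
      refine Finset.sum_congr rfl fun j hj => ?_
      have hij : j ≠ i := fun h => hi (h ▸ hj)
      have e1 : g (a j) = a j := hg _ (by simp [ha.ne hij, hab])
      have e2 : g (b j) = b j := hg _ (by simp [hb.ne hij, (hab i j).symm])
      simp [ordSign, e1, e2]

/-- The Mann-Whitney statistic of `A` and `B` (the excess of the pairs in which the element of
`A` comes first) is sub-Gaussian in a uniformly random ordering. -/
lemma expect_exp_sum_ordSign_le {n : ℕ} {A B : Finset (Fin n)} (hAB : Disjoint A B) {k : ℕ}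
    (hA : A.card = k) (hB : B.card = k) (hk : 0 < k) (t : ℝ) :
    𝔼 σ : Equiv.Perm (Fin n), Real.exp (t / k * ∑ u ∈ A, ∑ v ∈ B, ordSign σ u v)
      ≤ Real.exp (t ^ 2 / 2 * k) := by
  have : NeZero k := ⟨hk.ne'⟩
  have hk' : (0 : ℝ) < k := by exact_mod_cast hk
  let eA := A.equivFinOfCardEq hA
  let eB := B.equivFinOfCardEq hB
  let a : Fin k → Fin n := fun i => eA.symm i
  let b : Fin k → Fin n := fun i => eB.symm i
  have ha : Function.Injective a := Subtype.val_injective.comp eA.symm.injective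
  have hb : Function.Injective b := Subtype.val_injective.comp eB.symm.injective
  have hab : ∀ i j, a i ≠ b j := fun i j h =>
    Finset.disjoint_left.1 hAB (eA.symm i).2 (by
      have : ((eA.symm i : A) : Fin n) = eB.symm j := h
      rw [this]; exact (eB.symm j).2)
  have hsum : ∀ σ : Equiv.Perm (Fin n), ∑ u ∈ A, ∑ v ∈ B, ordSign σ u v =
      ∑ d : Fin k, ∑ i : Fin k, ordSign σ (a i) (b (i + d)) := by
    intro σ
    rw [Finset.sum_comm (s := Finset.univ), ← Finset.sum_coe_sort A, ← Equiv.sum_comp eA.symm]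
    refine Finset.sum_congr rfl fun i _ => ?_
    rw [← Finset.sum_coe_sort B, ← Equiv.sum_comp eB.symm]
    exact (Equiv.sum_comp (Equiv.addLeft i) fun j => ordSign σ (a i) (b j)).symm
  -- Hoeffding's device: the complete bipartite graph is the average of `k` perfect matchings.
  have hconv : ∀ σ : Equiv.Perm (Fin n),
      Real.exp (t / k * ∑ u ∈ A, ∑ v ∈ B, ordSign σ u v) ≤
      ∑ d : Fin k, (k : ℝ)⁻¹ * Real.exp (t * ∑ i : Fin k, ordSign σ (a i) (b (i + d))) := by
    intro σ
    have := convexOn_exp.map_sum_le (t := Finset.univ) (w := fun _ : Fin k => (k : ℝ)⁻¹)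
      (p := fun d => t * ∑ i : Fin k, ordSign σ (a i) (b (i + d)))
      (fun _ _ => by positivity) (by simp [hk'.ne']) (fun _ _ => Set.mem_univ _)
    simp only [smul_eq_mul] at this
    refine le_trans (le_of_eq ?_) this
    rw [hsum, ← Finset.mul_sum, ← Finset.mul_sum]
    congr 1
    ring
  calc _ ≤ 𝔼 σ : Equiv.Perm (Fin n), ∑ d : Fin k, (k : ℝ)⁻¹ *
        Real.exp (t * ∑ i : Fin k, ordSign σ (a i) (b (i + d))) :=
        Finset.expect_le_expect fun σ _ => hconv σ
    _ = ∑ d : Fin k, (k : ℝ)⁻¹ * 𝔼 σ : Equiv.Perm (Fin n),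
        Real.exp (t * ∑ i : Fin k, ordSign σ (a i) (b (i + d))) := by
        rw [Finset.expect_sum_comm]
        simp only [Finset.mul_expect]
    _ ≤ ∑ d : Fin k, (k : ℝ)⁻¹ * Real.exp (t ^ 2 / 2 * k) := by
        refine Finset.sum_le_sum fun d _ => mul_le_mul_of_nonneg_left ?_ (by positivity)
        have := expect_exp_sum_matching_le a (fun i => b (i + d)) ha
          (hb.comp (add_left_injective d)) (fun i j => hab _ _) t Finset.univ
        simpa using this
    _ = _ := by simp [hk'.ne']

lemma isPermInvariant_sum_ordSign {n : ℕ} {A B : Finset (Fin n)} (hAB : Disjoint A B) :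
    IsPermInvariant A (fun σ => ∑ u ∈ A, ∑ v ∈ B, ordSign σ u v) ∧
      IsPermInvariant B (fun σ => ∑ u ∈ A, ∑ v ∈ B, ordSign σ u v) := by
  have key : ∀ (W : Finset (Fin n)) (g : Equiv.Perm (Fin n)), (∀ x, x ∉ W → g x = x) →
      ∀ F : Fin n → ℝ, ∑ u ∈ W, F (g u) = ∑ u ∈ W, F u := by
    intro W g hg F
    refine Finset.sum_nbij' g g.symm (fun u hu => apply_mem_of_fixes_compl hg hu)
      (fun u hu => ?_) (by simp) (by simp) (by simp)
    refine apply_mem_of_fixes_compl (g := g.symm) (fun x hx => ?_) hu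
    rw [Equiv.symm_apply_eq, hg x hx]
  refine ⟨fun g hg σ => ?_, fun g hg σ => ?_⟩
  · change _ = ∑ u ∈ A, ∑ v ∈ B, ordSign σ u v
    rw [← key A g hg fun u => ∑ v ∈ B, ordSign σ u v]
    refine Finset.sum_congr rfl fun u _ => Finset.sum_congr rfl fun v hv => ?_
    simp [ordSign, hg v (Finset.disjoint_right.1 hAB hv)]
  · refine Finset.sum_congr rfl fun u hu => ?_
    rw [← key B g hg fun v => ordSign σ u v]
    refine Finset.sum_congr rfl fun v _ => ?_
    simp [ordSign, hg u (Finset.disjoint_left.1 hAB hu)]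

/-- Exponential moments multiply when potentials on disjoint sets `A`, `B`, `R` are combined with
a function of the Mann-Whitney statistic of `A` and `B`. -/
lemma expect_exp_add_le_one {n : ℕ} {A B R : Finset (Fin n)} (hAB : Disjoint A B)
    (hAR : Disjoint A R) (hBR : Disjoint B R) {fA fB fR : Equiv.Perm (Fin n) → ℝ} {φ : ℝ → ℝ}
    (hA : IsOrderLocal A fA) (hB : IsOrderLocal B fB) (hR : IsOrderLocal R fR)
    (eA : 𝔼 σ, Real.exp (fA σ) ≤ 1) (eB : 𝔼 σ, Real.exp (fB σ) ≤ 1)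
    (eR : 𝔼 σ, Real.exp (fR σ) ≤ 1)
    (eφ : 𝔼 σ : Equiv.Perm (Fin n), Real.exp (φ (∑ u ∈ A, ∑ v ∈ B, ordSign σ u v)) ≤ 1) :
    𝔼 σ, Real.exp (fA σ + (fB σ + (fR σ + φ (∑ u ∈ A, ∑ v ∈ B, ordSign σ u v)))) ≤ 1 := by
  obtain ⟨iA, iB⟩ := isPermInvariant_sum_ordSign hAB
  have jA : IsPermInvariant A
      fun σ => Real.exp (φ (∑ u ∈ A, ∑ v ∈ B, ordSign σ u v)) := fun g hg σ =>
    congrArg (fun x => Real.exp (φ x)) (iA g hg σ)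
  have jB : IsPermInvariant B
      fun σ => Real.exp (φ (∑ u ∈ A, ∑ v ∈ B, ordSign σ u v)) := fun g hg σ =>
    congrArg (fun x => Real.exp (φ x)) (iB g hg σ)
  have jR : IsPermInvariant R
      fun σ => Real.exp (φ (∑ u ∈ A, ∑ v ∈ B, ordSign σ u v)) := fun g hg σ => by
    refine congrArg (fun x => Real.exp (φ x)) ?_
    refine Finset.sum_congr rfl fun u hu => Finset.sum_congr rfl fun v hv => ?_
    simp [ordSign, hg u (Finset.disjoint_left.1 hAR hu), hg v (Finset.disjoint_left.1 hBR hv)]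
  have xA := hA.comp Real.exp
  have xB := hB.comp Real.exp
  have xR := hR.comp Real.exp
  have nn : ∀ f : Equiv.Perm (Fin n) → ℝ, 0 ≤ 𝔼 σ, Real.exp (f σ) := fun f =>
    Finset.expect_nonneg fun _ _ => (Real.exp_pos _).le
  simp only [Real.exp_add]
  rw [expect_mul_of_local_of_invariant xA ((xB.isPermInvariant hAB.symm).mul
      ((xR.isPermInvariant hAR.symm).mul jA)),
    expect_mul_of_local_of_invariant xB ((xR.isPermInvariant hBR.symm).mul jB),
    expect_mul_of_local_of_invariant xR jR]
  exact mul_le_one₀ eA (mul_nonneg (nn _) (mul_nonneg (nn _) (nn _)))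
    (mul_le_one₀ eB (mul_nonneg (nn _) (nn _)) (mul_le_one₀ eR (nn _) eφ))

/-! ### Upper regular pairs -/

lemma abs_sum_sum_le {V : Type*} {s : V → V → ℝ} {M : ℝ} (hs : ∀ u v, |s u v| ≤ M)
    (A B : Finset V) : |∑ u ∈ A, ∑ v ∈ B, s u v| ≤ M * (A.card * B.card) := by
  rw [← Finset.sum_product']
  refine (Finset.abs_sum_le_sum_abs _ _).trans
    ((Finset.sum_le_sum fun x _ => hs x.1 x.2).trans (le_of_eq ?_))
  simp [Finset.card_product]
  ring

/-- Density increment: a large set contains a pair `A`, `B` such that no pair of subsets of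
relative size `1 / N` has a density exceeding that of `A`, `B` by more than `η`. -/
lemma exists_upper_regular_pair {V : Type*} [DecidableEq V] {s : V → V → ℝ}
    (hs : ∀ u v, |s u v| ≤ 1) {N b : ℕ} {η : ℝ} (hN : 0 < N) (hη : 2 < N * η) (hb : 0 < b)
    {W : Finset V} (hW : 2 * (N ^ N * b) ≤ W.card) :
    ∃ (A B : Finset V) (l : ℕ) (c : ℝ), A ⊆ W ∧ B ⊆ W ∧ Disjoint A B ∧ A.card = N * l ∧
      B.card = N * l ∧ b ≤ l ∧ |c| ≤ 1 ∧
      ∑ u ∈ A, ∑ v ∈ B, s u v = c * ((N * l : ℕ) : ℝ) ^ 2 ∧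
      ∀ A' ⊆ A, ∀ B' ⊆ B, A'.card = l → B'.card = l →
        ∑ u ∈ A', ∑ v ∈ B', s u v ≤ (c + η) * (l : ℝ) ^ 2 := by
  by_contra hcon
  have key : ∀ j ≤ N, ∃ A B : Finset V, A ⊆ W ∧ B ⊆ W ∧ Disjoint A B ∧
      A.card = N ^ (N - j) * b ∧ B.card = N ^ (N - j) * b ∧
      (j * η - 1) * ((N ^ (N - j) * b : ℕ) : ℝ) ^ 2 ≤ ∑ u ∈ A, ∑ v ∈ B, s u v := by
    intro j
    induction j with
    | zero =>
      intro _
      obtain ⟨A, hA, hAc⟩ := Finset.exists_subset_card_eq (s := W) (n := N ^ N * b) (by omega)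
      obtain ⟨B, hB, hBc⟩ := Finset.exists_subset_card_eq (s := W \ A) (n := N ^ N * b)
        (by rw [Finset.card_sdiff_of_subset hA]; omega)
      refine ⟨A, B, hA, hB.trans Finset.sdiff_subset,
        (Finset.disjoint_sdiff.mono_right hB), hAc, hBc, ?_⟩
      have := (abs_le.1 (abs_sum_sum_le hs A B)).1
      rw [hAc, hBc] at this
      simp only [Nat.sub_zero, Nat.cast_zero]
      linarith
    | succ j ih =>
      intro hj
      obtain ⟨A, B, hA, hB, hd, hAc, hBc, hdens⟩ := ih (by omega)
      set l := N ^ (N - (j + 1)) * b with hl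
      have hNl : N ^ (N - j) * b = N * l := by
        rw [show N - j = N - (j + 1) + 1 by omega, pow_succ, hl]
        ring
      have hbl : b ≤ l := Nat.le_mul_of_pos_left b (pow_pos hN _)
      rw [hNl] at hAc hBc hdens
      have hpos : (0 : ℝ) < ((N * l : ℕ) : ℝ) ^ 2 := by
        have : 0 < N * l := Nat.mul_pos hN (hb.trans_le hbl)
        positivity
      let c := (∑ u ∈ A, ∑ v ∈ B, s u v) / ((N * l : ℕ) : ℝ) ^ 2
      have hc : ∑ u ∈ A, ∑ v ∈ B, s u v = c * ((N * l : ℕ) : ℝ) ^ 2 :=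
        (div_mul_cancel₀ _ hpos.ne').symm
      have hc1 : |c| ≤ 1 := by
        rw [abs_div, abs_of_pos hpos, div_le_one hpos]
        have := abs_sum_sum_le hs A B
        rw [hAc, hBc] at this
        linarith
      have hjc : j * η - 1 ≤ c := by
        rw [hc] at hdens
        exact le_of_mul_le_mul_right hdens hpos
      by_contra hno
      refine hcon ⟨A, B, l, c, hA, hB, hd, hAc, hBc, hbl, hc1, hc, fun A' hA' B' hB' h1 h2 => ?_⟩
      by_contra hlt
      refine hno ⟨A', B', hA'.trans hA, hB'.trans hB, hd.mono hA' hB', h1, h2, ?_⟩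
      push_cast
      refine le_trans (mul_le_mul_of_nonneg_right ?_ (sq_nonneg _)) (not_le.1 hlt).le
      linarith
  obtain ⟨A, B, -, -, -, hAc, hBc, h⟩ := key N le_rfl
  have h1 := (abs_le.1 (abs_sum_sum_le hs A B)).2
  rw [hAc, hBc] at h1
  simp only [Nat.sub_self, pow_zero, one_mul] at h h1
  have : (0 : ℝ) < (b : ℝ) ^ 2 := by positivity
  nlinarith

/-- A set of size `N * l` is cut by an ordering into `N` consecutive blocks of size `l`. -/
lemma exists_consecutive_blocks {n N l : ℕ} (σ : Equiv.Perm (Fin n)) {A : Finset (Fin n)}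
    (hA : A.card = N * l) :
    ∃ D : Fin N → Finset (Fin n), (∀ k, D k ⊆ A) ∧ (∀ k, (D k).card = l) ∧
      (∀ F : Fin n → ℝ, ∑ u ∈ A, F u = ∑ k, ∑ u ∈ D k, F u) ∧
      ∀ k k', k < k' → ∀ u ∈ D k, ∀ v ∈ D k', σ u < σ v := by
  have e := (A.map σ.toEmbedding).orderIsoOfFin ((Finset.card_map _).trans hA)
  let φ : Fin N → Fin l → Fin n := fun k j => σ.symm (e (finProdFinEquiv (k, j)))
  have hφ : ∀ k, Function.Injective (φ k) := fun k i j h => by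
    simpa [φ] using h
  have hmem : ∀ k j, φ k j ∈ A := fun k j => by
    have := (e (finProdFinEquiv (k, j))).2
    rw [Finset.mem_map_equiv] at this
    exact this
  refine ⟨fun k => Finset.univ.map ⟨φ k, hφ k⟩, fun k u hu => ?_, fun k => by simp, fun F => ?_,
    fun k k' hk u hu v hv => ?_⟩
  · obtain ⟨j, -, rfl⟩ := Finset.mem_map.1 hu
    exact hmem k j
  · have h1 : ∑ u ∈ A, F u = ∑ y ∈ A.map σ.toEmbedding, F (σ.symm y) := by simp
    rw [h1, ← Finset.sum_coe_sort, ← Equiv.sum_comp e.toEquiv, ← Equiv.sum_comp finProdFinEquiv,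
      Fintype.sum_prod_type]
    simp [φ]
  · obtain ⟨i, -, rfl⟩ := Finset.mem_map.1 hu
    obtain ⟨j, -, rfl⟩ := Finset.mem_map.1 hv
    simp only [Function.Embedding.coeFn_mk, φ, Equiv.apply_symm_apply]
    rw [Subtype.coe_lt_coe, e.lt_iff_lt, Fin.lt_def]
    simp only [finProdFinEquiv_apply_val]
    have h2 : (k : ℕ) + 1 ≤ k' := hk
    have := Nat.mul_le_mul_left l h2
    have := i.2
    rw [mul_add] at *
    omega

/-- For an upper regular pair, the agreement of any ordering with `s` exceeds by little what the
constant density `c` would give. Cutting both sets into consecutive blocks, all block pairs but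
the at most `2 * N` interlaced ones (one for each antidiagonal) are entirely in one order. -/
lemma sum_mul_ordSign_le {n N l : ℕ} {s : Fin n → Fin n → ℝ} (hs : ∀ u v, |s u v| ≤ 1)
    {A B : Finset (Fin n)} {c η : ℝ} (hη : 0 ≤ η) (hA : A.card = N * l) (hB : B.card = N * l)
    (hc1 : |c| ≤ 1)
    (hc : ∑ u ∈ A, ∑ v ∈ B, s u v = c * ((N * l : ℕ) : ℝ) ^ 2)
    (hreg : ∀ A' ⊆ A, ∀ B' ⊆ B, A'.card = l → B'.card = l →
        ∑ u ∈ A', ∑ v ∈ B', s u v ≤ (c + η) * (l : ℝ) ^ 2) (σ : Equiv.Perm (Fin n)) :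
    ∑ u ∈ A, ∑ v ∈ B, s u v * ordSign σ u v ≤
      c * ∑ u ∈ A, ∑ v ∈ B, ordSign σ u v + (2 * η * N ^ 2 + 8 * N) * (l : ℝ) ^ 2 := by
  obtain ⟨D, hDA, hDc, hDs, hDm⟩ := exists_consecutive_blocks σ hA
  obtain ⟨E, hEB, hEc, hEs, hEm⟩ := exists_consecutive_blocks σ hB
  let G : Fin n → Fin n → ℝ := fun u v => if σ u < σ v then s u v - c else 0
  have hG : ∀ u v, |G u v| ≤ 2 := fun u v => by
    have := (abs_sub (s u v) c).trans (add_le_add (hs u v) hc1)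
    simp only [G]
    split_ifs
    · linarith
    · simp
  let mixed : Finset (Fin N × Fin N) := Finset.univ.filter fun k =>
    (∃ u ∈ D k.1, ∃ v ∈ E k.2, σ u < σ v) ∧ ∃ u ∈ D k.1, ∃ v ∈ E k.2, ¬ σ u < σ v
  have hmixed : mixed.card ≤ 2 * N := by
    have h1 : mixed.card ≤ (Finset.range (2 * N)).card := by
      refine Finset.card_le_card_of_injOn (fun k => (k.1 : ℕ) + k.2) (fun k _ => ?_) ?_
      · have := k.1.2
        have := k.2.2
        simp only [Finset.coe_range, Set.mem_Iio]
        omega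
      · have hlt : ∀ k ∈ mixed, ∀ k' ∈ mixed, k.1 < k'.1 → ¬ k'.2 < k.2 := by
          intro k hk k' hk' h1 h2
          obtain ⟨-, -, u, hu, v, hv, huv⟩ := Finset.mem_filter.1 hk
          obtain ⟨-, ⟨u', hu', v', hv', huv'⟩, -⟩ := Finset.mem_filter.1 hk'
          exact huv ((hDm _ _ h1 u hu u' hu').trans (huv'.trans (hEm _ _ h2 v' hv' v hv)))
        intro k hk k' hk' h
        have a1 := hlt k hk k' hk'
        have a2 := hlt k' hk' k hk
        simp only [Fin.lt_def] at a1 a2 h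
        ext <;> omega
    simpa using h1
  have hblock : ∀ k k', ∑ u ∈ D k, ∑ v ∈ E k', G u v ≤
      η * (l : ℝ) ^ 2 + if (k, k') ∈ mixed then 2 * (l : ℝ) ^ 2 else 0 := by
    intro k k'
    have hηl : 0 ≤ η * (l : ℝ) ^ 2 := by positivity
    split_ifs with hm
    · have := (abs_le.1 (abs_sum_sum_le hG (D k) (E k'))).2
      rw [hDc, hEc] at this
      linarith
    · simp only [mixed, Finset.mem_filter, Finset.mem_univ, true_and, not_and_or] at hm
      rcases hm with hm | hm
      · push Not at hm
        have : ∑ u ∈ D k, ∑ v ∈ E k', G u v = 0 :=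
          Finset.sum_eq_zero fun u hu => Finset.sum_eq_zero fun v hv => by
            simp [G, hm u hu v hv]
        linarith
      · push Not at hm
        have h1 : ∑ u ∈ D k, ∑ v ∈ E k', G u v = ∑ u ∈ D k, ∑ v ∈ E k', (s u v - c) :=
          Finset.sum_congr rfl fun u hu => Finset.sum_congr rfl fun v hv => by
            simp [G, hm u hu v hv]
        have h2 := hreg _ (hDA k) _ (hEB k') (hDc k) (hEc k')
        rw [h1]
        simp only [Finset.sum_sub_distrib, Finset.sum_const, hDc, hEc, nsmul_eq_mul]
        linarith
  have hGsum : ∑ u ∈ A, ∑ v ∈ B, G u v ≤ (η * N ^ 2 + 4 * N) * (l : ℝ) ^ 2 := by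
    have h1 : ∑ u ∈ A, ∑ v ∈ B, G u v = ∑ k, ∑ k', ∑ u ∈ D k, ∑ v ∈ E k', G u v := by
      rw [hDs]
      refine Finset.sum_congr rfl fun k _ => ?_
      rw [Finset.sum_comm, hEs]
      exact Finset.sum_congr rfl fun k' _ => Finset.sum_comm
    have h2 : ∑ k : Fin N, ∑ k' : Fin N, (if (k, k') ∈ mixed then 2 * (l : ℝ) ^ 2 else 0) =
        mixed.card * (2 * (l : ℝ) ^ 2) := by
      rw [← Fintype.sum_prod_type' (f := fun k k' : Fin N =>
        if (k, k') ∈ mixed then 2 * (l : ℝ) ^ 2 else 0)]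
      simp
    rw [h1]
    refine (Finset.sum_le_sum fun k _ => Finset.sum_le_sum fun k' _ => hblock k k').trans ?_
    simp only [Finset.sum_add_distrib, h2]
    have h3 : (mixed.card : ℝ) ≤ 2 * N := by exact_mod_cast hmixed
    have h4 := mul_le_mul_of_nonneg_right h3 (show (0 : ℝ) ≤ 2 * (l : ℝ) ^ 2 by positivity)
    simp only [Finset.sum_const, Finset.card_univ, Fintype.card_fin, nsmul_eq_mul]
    linarith
  have hexp : ∑ u ∈ A, ∑ v ∈ B, s u v * ordSign σ u v = c * ∑ u ∈ A, ∑ v ∈ B, ordSign σ u v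
      + 2 * (∑ u ∈ A, ∑ v ∈ B, G u v)
      - (∑ u ∈ A, ∑ v ∈ B, s u v - ∑ u ∈ A, ∑ v ∈ B, c) := by
    simp only [Finset.mul_sum, ← Finset.sum_add_distrib, ← Finset.sum_sub_distrib]
    refine Finset.sum_congr rfl fun u _ => Finset.sum_congr rfl fun v _ => ?_
    simp only [G, ordSign]
    split_ifs <;> ring
  have hcc : ∑ u ∈ A, ∑ v ∈ B, c = c * ((N * l : ℕ) : ℝ) ^ 2 := by
    simp only [Finset.sum_const, hA, hB, nsmul_eq_mul]
    ring
  rw [hexp, hc, hcc]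
  linarith

/-! ### Gibbs' inequality and the potential -/

/-- Gibbs' inequality: a potential with exponential moment at most `1` under the uniform
distribution bounds the entropy deficit from below by its expectation. -/
lemma entropy_le_sub_of_expect_exp_le_one {n : ℕ} {p Φ : Equiv.Perm (Fin n) → ℝ}
    (hp : ∀ σ, 0 ≤ p σ) (hp1 : ∑ σ, p σ = 1) (hΦ : 𝔼 σ, Real.exp (Φ σ) ≤ 1) :
    -∑ σ, p σ * Real.log (p σ) ≤ Real.log n.factorial - ∑ σ, p σ * Φ σ := by
  have hf : (0 : ℝ) < n.factorial := by exact_mod_cast n.factorial_pos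
  have hterm : ∀ σ, p σ * (Φ σ - Real.log n.factorial - Real.log (p σ)) ≤
      Real.exp (Φ σ) / n.factorial - p σ := by
    intro σ
    rcases (hp σ).eq_or_lt with h | h
    · rw [← h]
      simp only [zero_mul, sub_zero]
      positivity
    · have h1 := Real.log_le_sub_one_of_pos
        (show 0 < Real.exp (Φ σ) / (n.factorial * p σ) by positivity)
      rw [Real.log_div (Real.exp_pos _).ne' (by positivity), Real.log_exp,
        Real.log_mul hf.ne' h.ne'] at h1
      have h2 := mul_le_mul_of_nonneg_left h1 h.le
      have h3 : p σ * (Real.exp (Φ σ) / (n.factorial * p σ) - 1) =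
          Real.exp (Φ σ) / n.factorial - p σ := by
        field_simp
      rw [h3] at h2
      linarith
  have hsum := Finset.sum_le_sum fun σ (_ : σ ∈ Finset.univ) => hterm σ
  rw [Finset.expect_eq_sum_div_card, Finset.card_univ, Fintype.card_perm, Fintype.card_fin] at hΦ
  simp only [mul_sub, Finset.sum_sub_distrib, ← Finset.sum_mul, ← Finset.sum_div, hp1] at hsum
  linarith

lemma expect_exp_sub_le_one {n : ℕ} {f : Equiv.Perm (Fin n) → ℝ} {x y : ℝ}
    (h : 𝔼 σ, Real.exp (f σ) ≤ Real.exp x) (hxy : x ≤ y) :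
    𝔼 σ, Real.exp (f σ - y) ≤ 1 := by
  simp only [Real.exp_sub, div_eq_mul_inv]
  rw [← Finset.expect_mul, ← div_eq_mul_inv, div_le_one (Real.exp_pos _)]
  exact h.trans (Real.exp_le_exp.2 hxy)

/-- The function `w * log (w / K)` loses only a multiple of `a` when `w` is split as
`a + a + r` with `a` a constant proportion of `w`. -/
lemma mul_log_div_le_split {w a r K L : ℝ} (ha : 0 < a) (hr : 0 ≤ r) (hw : w = 2 * a + r)
    (hK : 0 < K) (hL : Real.log w ≤ L + Real.log a) :
    w * Real.log (w / K) ≤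
      2 * (a * Real.log (a / K)) + r * Real.log (r / K) + 2 * (L + 1) * a := by
  have hw0 : 0 < w := by linarith
  rw [Real.log_div hw0.ne' hK.ne', Real.log_div ha.ne' hK.ne']
  have h1 := mul_le_mul_of_nonneg_left hL ha.le
  have h2 : r * Real.log (r / K) = r * (Real.log r - Real.log K) := by
    rcases hr.eq_or_lt with h | h
    · simp [← h]
    · rw [Real.log_div h.ne' hK.ne']
  have h3 : r * (Real.log w - Real.log r) ≤ w - r := by
    rcases hr.eq_or_lt with h | h
    · rw [← h]
      linarith
    · have := Real.log_le_sub_one_of_pos (show 0 < w / r by positivity)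
      rw [Real.log_div hw0.ne' h.ne'] at this
      refine (mul_le_mul_of_nonneg_left this h.le).trans (le_of_eq ?_)
      field_simp
  have h4 : w * (Real.log w - Real.log K) =
    2 * (a * Real.log w) + r * Real.log w - (2 * (a * Real.log K) + r * Real.log K) := by
    nth_rewrite 1 [hw]
    ring
  rw [h2, h4]
  linarith

/-- The recursive construction of the potential. On a large set `W` an upper regular pair
`A`, `B` contributes a multiple of its Mann-Whitney statistic, in addition to the potentials of
`A`, `B` and the rest of `W`. -/
lemma exists_potential {n : ℕ} {s : Fin n → Fin n → ℝ} (hs : ∀ u v, |s u v| ≤ 1)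
    {p : Equiv.Perm (Fin n) → ℝ} (hp : ∀ σ, 0 ≤ p σ) (hp1 : ∑ σ, p σ = 1) {ε : ℝ} (hε : 0 < ε)
    (hsp : ∀ u v, u ≠ v → 2 * ε ≤ ∑ σ, p σ * (s u v * ordSign σ u v))
    {N : ℕ} (hN : 0 < N) (hNε : 16 ≤ N * ε) (W : Finset (Fin n)) :
    ∃ Φ : Equiv.Perm (Fin n) → ℝ, IsOrderLocal W Φ ∧ 𝔼 σ, Real.exp (Φ σ) ≤ 1 ∧
      ε ^ 2 / (4 * (Real.log (4 * N ^ N) + 1)) * (W.card * Real.log (W.card / (2 * N ^ N))) ≤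
        ∑ σ, p σ * Φ σ := by
  have hNN : (1 : ℝ) ≤ (N : ℝ) ^ N := one_le_pow₀ (by exact_mod_cast hN)
  set L := Real.log (4 * N ^ N) with hLdef
  have hL : 0 < L := Real.log_pos (by linarith)
  set θ := ε ^ 2 / (4 * (L + 1)) with hθ
  have hθ0 : 0 < θ := by positivity
  induction W using Finset.strongInduction with
  | H W ih =>
  have hNn : 0 < N ^ N := pow_pos hN _
  rcases lt_or_ge W.card (2 * N ^ N) with hsmall | hbig
  · refine ⟨fun _ => 0, fun _ _ _ => rfl, by simp, ?_⟩
    have h1 : (W.card : ℝ) ≤ 2 * N ^ N := by exact_mod_cast hsmall.le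
    have h2 : Real.log (W.card / (2 * N ^ N)) ≤ 0 :=
      Real.log_nonpos (by positivity) (div_le_one_of_le₀ h1 (by positivity))
    simp only [mul_zero, Finset.sum_const_zero]
    exact mul_nonpos_of_nonneg_of_nonpos hθ0.le
      (mul_nonpos_of_nonneg_of_nonpos (Nat.cast_nonneg _) h2)
  · set b := W.card / (2 * N ^ N) with hb
    have hb0 : 0 < b := Nat.div_pos hbig (by positivity)
    have hbW : 2 * (N ^ N * b) ≤ W.card := by
      rw [← mul_assoc]
      exact Nat.mul_div_le _ _
    have hWb : W.card ≤ 4 * N ^ N * b := by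
      have h1 := Nat.lt_mul_div_succ W.card (show 0 < 2 * N ^ N by positivity)
      rw [← hb] at h1
      have h2 := Nat.mul_le_mul_left (2 * N ^ N) hb0
      linarith
    obtain ⟨A, B, l, c, hAW, hBW, hAB, hA, hB, hbl, hc1, hc, hreg⟩ :=
      exists_upper_regular_pair hs (η := ε / 4) hN (by linarith) hb0 hbW
    have hagree := sum_mul_ordSign_le hs (by positivity : 0 ≤ ε / 4) hA hB hc1 hc hreg
    set a := N * l with ha
    have ha0 : 0 < a := Nat.mul_pos hN (hb0.trans_le hbl)
    have ha0' : (0 : ℝ) < a := by exact_mod_cast ha0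
    have hba : b ≤ a := hbl.trans (Nat.le_mul_of_pos_left l hN)
    have hABW : A ∪ B ⊆ W := Finset.union_subset hAW hBW
    have hcardAB : (A ∪ B).card = 2 * a := by
      rw [Finset.card_union_of_disjoint hAB, hA, hB]; ring
    have hcardR : W.card = 2 * a + (W \ (A ∪ B)).card := by
      rw [Finset.card_sdiff_of_subset hABW, hcardAB]
      have := Finset.card_le_card hABW
      omega
    have hss : ∀ S ⊆ W, S.card < W.card → S ⊂ W := fun S hS hlt =>
      hS.ssubset_of_ne (by rintro rfl; exact lt_irrefl _ hlt)
    obtain ⟨ΦA, locA, expA, potA⟩ := ih A (hss A hAW (by omega))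
    obtain ⟨ΦB, locB, expB, potB⟩ := ih B (hss B hBW (by omega))
    obtain ⟨ΦR, locR, expR, potR⟩ := ih (W \ (A ∪ B)) (hss _ Finset.sdiff_subset (by omega))
    have hAR : Disjoint A (W \ (A ∪ B)) :=
      Finset.disjoint_sdiff.mono_left Finset.subset_union_left
    have hBR : Disjoint B (W \ (A ∪ B)) :=
      Finset.disjoint_sdiff.mono_left Finset.subset_union_right
    let φ : ℝ → ℝ := fun x => ε * c / a * x - ε ^ 2 / 2 * a
    have hφ : 𝔼 σ : Equiv.Perm (Fin n),
        Real.exp (φ (∑ u ∈ A, ∑ v ∈ B, ordSign σ u v)) ≤ 1 := by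
      refine expect_exp_sub_le_one (expect_exp_sum_ordSign_le hAB hA hB ha0 (ε * c)) ?_
      have : c ^ 2 ≤ 1 := (sq_le_one_iff_abs_le_one c).2 hc1
      have h2 : (ε * c) ^ 2 ≤ ε ^ 2 := by
        rw [mul_pow]
        exact mul_le_of_le_one_right (sq_nonneg _) this
      have := mul_le_mul_of_nonneg_right h2 ha0'.le
      linarith
    refine ⟨_, ?_, expect_exp_add_le_one hAB hAR hBR locA locB locR expA expB expR hφ, ?_⟩
    · intro σ τ h
      dsimp only
      rw [locA.mono hAW σ τ h, locB.mono hBW σ τ h, locR.mono Finset.sdiff_subset σ τ h]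
      congr 4
      refine Finset.sum_congr rfl fun u hu => Finset.sum_congr rfl fun v hv => ?_
      simp only [ordSign, h u (hAW hu) v (hBW hv)]
    · -- The pair `A`, `B` contributes at least `ε ^ 2 / 2 * a`.
      have h1 : 2 * ε * (a : ℝ) ^ 2 ≤
          ∑ σ, p σ * ∑ u ∈ A, ∑ v ∈ B, s u v * ordSign σ u v := by
        have e1 : ∑ σ, p σ * ∑ u ∈ A, ∑ v ∈ B, s u v * ordSign σ u v =
            ∑ u ∈ A, ∑ v ∈ B, ∑ σ, p σ * (s u v * ordSign σ u v) := by
          simp only [Finset.mul_sum]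
          rw [Finset.sum_comm]
          exact Finset.sum_congr rfl fun u _ => Finset.sum_comm
        have e2 : 2 * ε * (a : ℝ) ^ 2 = ∑ u ∈ A, ∑ v ∈ B, 2 * ε := by
          simp only [Finset.sum_const, hA, hB, nsmul_eq_mul]
          ring
        rw [e1, e2]
        exact Finset.sum_le_sum fun u hu => Finset.sum_le_sum fun v hv =>
          hsp u v fun h => Finset.disjoint_left.1 hAB hu (h ▸ hv)
      have herr : (2 * (ε / 4) * (N : ℝ) ^ 2 + 8 * N) * (l : ℝ) ^ 2 ≤ ε * (a : ℝ) ^ 2 := by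
        have hN' : (0 : ℝ) ≤ N := Nat.cast_nonneg _
        have : 8 * (N : ℝ) ≤ ε / 2 * (N : ℝ) ^ 2 := by nlinarith
        have := mul_le_mul_of_nonneg_right this (sq_nonneg (l : ℝ))
        rw [ha]
        push_cast
        linarith
      have h2 : 2 * ε * (a : ℝ) ^ 2 ≤
          c * ∑ σ, p σ * ∑ u ∈ A, ∑ v ∈ B, ordSign σ u v + ε * (a : ℝ) ^ 2 := by
        refine h1.trans ((Finset.sum_le_sum fun σ _ => mul_le_mul_of_nonneg_left
          ((hagree σ).trans (add_le_add_right herr _)) (hp σ)).trans (le_of_eq ?_))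
        simp only [mul_add, Finset.sum_add_distrib, ← Finset.sum_mul, hp1, one_mul,
          Finset.mul_sum (s := Finset.univ) (a := c)]
        congr 1
        exact Finset.sum_congr rfl fun σ _ => by ring
      have h3 : ε ^ 2 / 2 * a ≤ ∑ σ, p σ * φ (∑ u ∈ A, ∑ v ∈ B, ordSign σ u v) := by
        have e1 : ∑ σ, p σ * φ (∑ u ∈ A, ∑ v ∈ B, ordSign σ u v) =
            ε / a * (c * ∑ σ, p σ * ∑ u ∈ A, ∑ v ∈ B, ordSign σ u v) - ε ^ 2 / 2 * a := by
          simp only [φ, mul_sub, Finset.sum_sub_distrib, ← Finset.sum_mul, hp1, one_mul,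
            Finset.mul_sum (s := Finset.univ)]
          congr 1
          exact Finset.sum_congr rfl fun σ _ => by ring
        have e2 : ε * (a : ℝ) ^ 2 ≤ c * ∑ σ, p σ * ∑ u ∈ A, ∑ v ∈ B, ordSign σ u v := by
          linarith
        have e3 := mul_le_mul_of_nonneg_left e2 (show 0 ≤ ε / a by positivity)
        have e4 : ε / a * (ε * (a : ℝ) ^ 2) = ε ^ 2 * a := by field_simp
        rw [e1]
        linarith
      have hlog : Real.log W.card ≤ L + Real.log a := by
        rw [hLdef, ← Real.log_mul (by positivity) ha0'.ne']
        refine Real.log_le_log (by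
          have : 0 < W.card := by omega
          exact_mod_cast this) ?_
        have : W.card ≤ 4 * N ^ N * a := hWb.trans (Nat.mul_le_mul_left _ hba)
        exact_mod_cast this
      have h4 := mul_log_div_le_split (K := 2 * N ^ N) ha0'
        (Nat.cast_nonneg (W \ (A ∪ B)).card) (by exact_mod_cast hcardR) (by positivity) hlog
      have h5 := mul_le_mul_of_nonneg_left h4 hθ0.le
      have h6 : θ * (2 * (L + 1) * a) = ε ^ 2 / 2 * a := by
        rw [hθ]; field_simp; ring
      rw [hA] at potA
      rw [hB] at potB
      simp only [mul_add, Finset.sum_add_distrib] at h5 h6 ⊢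
      linarith

/-! ### The entropy bound -/

lemma log_factorial_le (n : ℕ) : Real.log n.factorial ≤ n * Real.log n := by
  rw [← Real.log_pow]
  exact Real.log_le_log (by exact_mod_cast n.factorial_pos)
    (by exact_mod_cast Nat.factorial_le_pow n)

/-- The choice of the number `N` of blocks, and the comparison of `exp (-ε ^ (-20))` with the
entropy deficits available for small and for large ground sets. -/
lemma exists_block_count {ε : ℝ} (hε : 0 < ε) (hε2 : ε < 1 / 2) :
    ∃ N : ℕ, 0 < N ∧ 16 ≤ N * ε ∧
      Real.exp (-(ε ^ (-20 : ℝ))) * (2 * (N : ℝ) ^ N) ^ 4 ≤ 2 * ε ^ 2 ∧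
      Real.exp (-(ε ^ (-20 : ℝ))) ≤ ε ^ 2 / (8 * (Real.log (4 * N ^ N) + 1)) := by
  obtain ⟨x, hx⟩ : ∃ x, x = ε⁻¹ := ⟨_, rfl⟩
  have hx0 : 0 < x := hx ▸ inv_pos.2 hε
  have hεx : ε = x⁻¹ := by rw [hx, inv_inv]
  have hx2 : 2 < x := by
    rw [hx, lt_inv_comm₀ two_pos hε]
    linarith
  have hpow : ε ^ (-20 : ℝ) = x ^ 20 := by
    rw [Real.rpow_neg hε.le, hx, inv_pow, ← Real.rpow_natCast]
    norm_num
  rw [hpow]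
  have hN16 := Nat.le_ceil (16 * x)
  have hN17 : (⌈16 * x⌉₊ : ℝ) ≤ 17 * x := by
    have := (Nat.ceil_lt_add_one (show 0 ≤ 16 * x by positivity)).le
    linarith
  refine ⟨⌈16 * x⌉₊, Nat.ceil_pos.2 (by positivity), ?_⟩
  generalize ⌈16 * x⌉₊ = N at hN16 hN17
  have hNpos : (0 : ℝ) < N := by linarith
  have hNlog : N * Real.log N ≤ 289 * x ^ 2 := by
    have := mul_le_mul_of_nonneg_left (Real.log_le_self hNpos.le) hNpos.le
    nlinarith
  have hNexp : (N : ℝ) ^ N ≤ Real.exp (289 * x ^ 2) := by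
    rw [← Real.log_le_iff_le_exp (by positivity), Real.log_pow]
    exact hNlog
  have hx4 : 4 < x ^ 2 := by nlinarith
  refine ⟨?_, ?_, ?_⟩
  · rw [hεx, ← div_eq_mul_inv, le_div_iff₀ hx0]
    exact hN16
  · have h1 : (2 * (N : ℝ) ^ N) ^ 4 ≤ 16 * Real.exp (1156 * x ^ 2) := by
      rw [mul_pow]
      have := pow_le_pow_left₀ (by positivity) hNexp 4
      rw [← Real.exp_nat_mul] at this
      norm_num at this ⊢
      refine this.trans (le_of_eq ?_)
      congr 1; ring
    have h2 : (16 : ℝ) ≤ Real.exp (15 * x ^ 2) := by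
      have := Real.add_one_le_exp (15 * x ^ 2)
      linarith
    have h3 : 1172 * x ^ 2 ≤ x ^ 20 := by
      have : (4 : ℝ) ^ 9 ≤ (x ^ 2) ^ 9 := pow_le_pow_left₀ (by norm_num) hx4.le 9
      have e : x ^ 20 = (x ^ 2) ^ 9 * x ^ 2 := by ring
      rw [e]
      exact mul_le_mul_of_nonneg_right (by linarith) (sq_nonneg x)
    calc Real.exp (-(x ^ 20)) * (2 * (N : ℝ) ^ N) ^ 4
        ≤ Real.exp (-(1172 * x ^ 2)) * (Real.exp (15 * x ^ 2) * Real.exp (1156 * x ^ 2)) := by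
          refine mul_le_mul (Real.exp_le_exp.2 (by linarith)) (h1.trans ?_) (by positivity)
            (Real.exp_pos _).le
          exact mul_le_mul_of_nonneg_right h2 (Real.exp_pos _).le
      _ = (Real.exp (x ^ 2))⁻¹ := by
          rw [← Real.exp_add, ← Real.exp_add, ← Real.exp_neg]
          congr 1; ring
      _ ≤ (x ^ 2)⁻¹ := by
          refine inv_anti₀ (by positivity) ?_
          linarith [Real.add_one_le_exp (x ^ 2)]
      _ ≤ 2 * ε ^ 2 := by
          rw [hεx, inv_pow]
          have : 0 < (x ^ 2)⁻¹ := by positivity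
          linarith
  · have hL : Real.log (4 * (N : ℝ) ^ N) ≤ 3 + 289 * x ^ 2 := by
      rw [Real.log_mul (by norm_num) (by positivity), Real.log_pow]
      have := Real.log_le_sub_one_of_pos (show (0 : ℝ) < 4 by norm_num)
      linarith
    have hL0 : 0 < Real.log (4 * (N : ℝ) ^ N) := by
      refine Real.log_pos ?_
      have : (1 : ℝ) ≤ (N : ℝ) ^ N := one_le_pow₀ (by linarith)
      linarith
    rw [hεx, inv_pow, Real.exp_neg, inv_eq_one_div (x ^ 2), div_div, ← one_div]
    refine one_div_le_one_div_of_le (by positivity) ?_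
    have h1 : (4 : ℝ) ^ 8 ≤ (x ^ 2) ^ 8 := pow_le_pow_left₀ (by norm_num) hx4.le 8
    have h2 : x ^ 20 = (x ^ 2) ^ 8 * (x ^ 2 * x ^ 2) := by ring
    have h3 : (4 : ℝ) ^ 8 * (x ^ 2 * x ^ 2) ≤ x ^ 20 := by
      rw [h2]
      exact mul_le_mul_of_nonneg_right h1 (by positivity)
    have h4 : x ^ 2 * (8 * (Real.log (4 * (N : ℝ) ^ N) + 1)) ≤ x ^ 2 * (4096 * x ^ 2) :=
      mul_le_mul_of_nonneg_left (by linarith) (sq_nonneg x)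
    have h5 := Real.add_one_le_exp (x ^ 20)
    have h6 : 0 < x ^ 2 * x ^ 2 := by positivity
    linarith

/-- The entropy bound for a distribution `p` on orderings, in nats. -/
lemma entropy_le_of_sign_correlation {n : ℕ} {s : Fin n → Fin n → ℝ} (hs : ∀ u v, |s u v| ≤ 1)
    {p : Equiv.Perm (Fin n) → ℝ} (hp : ∀ σ, 0 ≤ p σ) (hp1 : ∑ σ, p σ = 1) {ε : ℝ} (hε : 0 < ε)
    (hε2 : ε < 1 / 2)
    (hsp : ∀ u v, u ≠ v → 2 * ε ≤ ∑ σ, p σ * (s u v * ordSign σ u v)) (hn : 2 ≤ n) :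
    -∑ σ, p σ * Real.log (p σ) ≤
      (1 - Real.exp (-(ε ^ (-20 : ℝ)))) * Real.log n.factorial := by
  obtain ⟨N, hN, hNε, hsmall, hlarge⟩ := exists_block_count hε hε2
  have hNN : (1 : ℝ) ≤ (N : ℝ) ^ N := one_le_pow₀ (by exact_mod_cast hN)
  have hn0 : (0 : ℝ) < n := by exact_mod_cast (show 0 < n by omega)
  have hlogn : 0 ≤ Real.log n := Real.log_natCast_nonneg n
  have hfact := log_factorial_le n
  have hϑ := (Real.exp_pos (-(ε ^ (-20 : ℝ)))).le
  generalize Real.exp (-(ε ^ (-20 : ℝ))) = ϑ at hsmall hlarge hϑ ⊢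
  suffices h : ∃ Φ : Equiv.Perm (Fin n) → ℝ, 𝔼 σ, Real.exp (Φ σ) ≤ 1 ∧
      ϑ * Real.log n.factorial ≤ ∑ σ, p σ * Φ σ by
    obtain ⟨Φ, h1, h2⟩ := h
    have := entropy_le_sub_of_expect_exp_le_one hp hp1 h1
    linarith
  have hfact0 : 0 ≤ Real.log n.factorial := Real.log_natCast_nonneg _
  rcases le_or_gt (n : ℝ) ((2 * (N : ℝ) ^ N) ^ 2) with h | h
  · -- For small `n` the information about a single pair suffices.
    let u : Fin n := ⟨0, by omega⟩
    let v : Fin n := ⟨1, by omega⟩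
    have huv : u ≠ v := by simp [u, v]
    refine ⟨fun σ => 2 * ε * s u v * ordSign σ u v - 2 * ε ^ 2,
      expect_exp_sub_le_one (expect_exp_ordSign_le huv _) ?_, ?_⟩
    · have : s u v ^ 2 ≤ 1 := (sq_le_one_iff_abs_le_one _).2 (hs u v)
      nlinarith [sq_nonneg ε]
    · have h1 : ∑ σ, p σ * (2 * ε * s u v * ordSign σ u v - 2 * ε ^ 2) =
          2 * ε * ∑ σ, p σ * (s u v * ordSign σ u v) - 2 * ε ^ 2 := by
        simp only [mul_sub, Finset.sum_sub_distrib, ← Finset.sum_mul, hp1, one_mul,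
          Finset.mul_sum]
        congr 1
        exact Finset.sum_congr rfl fun σ _ => by ring
      have h2 := mul_le_mul_of_nonneg_left (hsp u v huv) (show 0 ≤ 2 * ε by positivity)
      have h3 : Real.log n.factorial ≤ (2 * (N : ℝ) ^ N) ^ 4 := by
        refine hfact.trans ((mul_le_mul_of_nonneg_left (Real.log_le_self hn0.le) hn0.le).trans ?_)
        calc (n : ℝ) * n ≤ (2 * (N : ℝ) ^ N) ^ 2 * (2 * (N : ℝ) ^ N) ^ 2 :=
              mul_le_mul h h hn0.le (by positivity)
          _ = _ := by ring
      rw [h1]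
      have h4 := mul_le_mul_of_nonneg_left h3 hϑ
      linarith
  · obtain ⟨Φ, -, h1, h2⟩ := exists_potential hs hp hp1 hε hsp hN hNε Finset.univ
    refine ⟨Φ, h1, le_trans ?_ h2⟩
    have hL0 : 0 < Real.log (4 * (N : ℝ) ^ N) := Real.log_pos (by linarith)
    rw [Finset.card_univ, Fintype.card_fin, Real.log_div hn0.ne' (by positivity)]
    have h3 := Real.log_le_log (by positivity) h.le
    rw [Real.log_pow] at h3
    push_cast at h3
    calc ϑ * Real.log n.factorial
        ≤ ε ^ 2 / (8 * (Real.log (4 * N ^ N) + 1)) * (n * Real.log n) :=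
          mul_le_mul hlarge hfact hfact0 (by positivity)
      _ = ε ^ 2 / (4 * (Real.log (4 * N ^ N) + 1)) * (n * (Real.log n / 2)) := by
          field_simp; ring
      _ ≤ _ := by
          refine mul_le_mul_of_nonneg_left (mul_le_mul_of_nonneg_left ?_ hn0.le) (by positivity)
          linarith

lemma measureReal_preimage_eq_sum {Ω S : Type*} [MeasurableSpace Ω] [Fintype S]
    (P : Measure Ω) [IsProbabilityMeasure P] {X : Ω → S} (hX : Measurable[_, ⊤] X)
    (q : S → Prop) [DecidablePred q] :
    P.real {ω | q (X ω)} = ∑ x with q x, P.real (X ⁻¹' {x}) := by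
  rw [← measureReal_biUnion_finset]
  · congr 1
    ext ω
    simp
  · intro x _ y _ hxy
    exact Disjoint.preimage X (Set.disjoint_singleton.2 hxy)
  · intro x _
    exact hX trivial

theorem theorem1 :
    ∃ ϑ : ℝ → ℝ,
      (∀ ε : ℝ, 0 < ε → 0 < ϑ ε) ∧
      (∃ C : ℝ, 0 < C ∧ ∀ ε : ℝ, 0 < ε → ε < 1 / 2 → ϑ ε = Real.exp (-(ε ^ (-C)))) ∧
      ∀ (ε : ℝ), 0 < ε →
      ∀ (n : ℕ) (T : Digraph (Fin n)), IsTournament T →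
      ∀ (Ω : Type*) [mΩ : MeasurableSpace Ω] (P : Measure Ω) [IsProbabilityMeasure P]
        (σ : Ω → Equiv.Perm (Fin n)), Measurable[mΩ, ⊤] σ →
        (∀ u v : Fin n, T.Adj u v → P.real {ω | σ ω u < σ ω v} > 1 / 2 + ε) →
        entropyTwo P σ ≤ (1 - ϑ ε) * Real.logb 2 (n.factorial : ℝ) := by
  classical
  refine ⟨fun ε => Real.exp (-(ε ^ (-20 : ℝ))), fun _ _ => Real.exp_pos _,
    ⟨20, by norm_num, fun _ _ _ => rfl⟩, ?_⟩
  intro ε hε n T hT Ω mΩ P _ σ hσ hP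
  let p : Equiv.Perm (Fin n) → ℝ := fun x => P.real (σ ⁻¹' {x})
  have hp : ∀ x, 0 ≤ p x := fun x => measureReal_nonneg
  have hp1 : ∑ x, p x = 1 := by
    have := measureReal_preimage_eq_sum P hσ fun _ => True
    simpa using this.symm
  have hlog2 : 0 < Real.log 2 := Real.log_pos (by norm_num)
  have hent : entropyTwo P σ = (-∑ x, p x * Real.log (p x)) / Real.log 2 := by
    simp only [entropyTwo, Real.logb, neg_div, Finset.sum_div, mul_div_assoc, p]
  rw [hent, Real.logb, ← mul_div_assoc]
  refine div_le_div_of_nonneg_right ?_ hlog2.le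
  rcases lt_or_ge n 2 with hn | hn
  · have h1 : n.factorial = 1 := Nat.factorial_eq_one.2 (by omega)
    have := entropy_le_sub_of_expect_exp_le_one hp hp1 (Φ := fun _ => 0) (by simp)
    simpa [h1] using this
  have htot : ∀ u v : Fin n, u ≠ v → T.Adj u v ∨ T.Adj v u := fun u v h => (hT.2 u v h).or
  have hε2 : ε < 1 / 2 := by
    have hle : ∀ u v : Fin n, P.real {ω | σ ω u < σ ω v} ≤ 1 := fun u v => measureReal_le_one
    rcases htot ⟨0, by omega⟩ ⟨1, by omega⟩ (by simp) with h | h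
    · linarith [hP _ _ h, hle ⟨0, by omega⟩ ⟨1, by omega⟩]
    · linarith [hP _ _ h, hle ⟨1, by omega⟩ ⟨0, by omega⟩]
  have hcorr : ∀ u v : Fin n, T.Adj u v → 2 * ε ≤ ∑ x, p x * ordSign x u v := by
    intro u v h
    have h1 := hP u v h
    rw [measureReal_preimage_eq_sum P hσ fun x => x u < x v] at h1
    have h2 : ∑ x, p x * ordSign x u v = 2 * ∑ x with x u < x v, p x - ∑ x, p x := by
      rw [Finset.sum_filter, Finset.mul_sum, ← Finset.sum_sub_distrib]
      refine Finset.sum_congr rfl fun x _ => ?_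
      unfold ordSign
      split_ifs <;> ring
    rw [h2, hp1]
    linarith
  refine entropy_le_of_sign_correlation (s := fun u v => if T.Adj u v then 1 else -1)
    (fun u v => by split_ifs <;> simp) hp hp1 hε hε2 (fun u v huv => ?_) hn
  split_ifs with h
  · simpa using hcorr u v h
  · have := hcorr v u ((htot u v huv).resolve_left h)
    simpa [ordSign_swap _ huv] using this
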